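/- Let $G$ be a topological group. A $G$-flow is a nonempty compact Hausdorff space with a jointly continuous action of $G$; a $G$-map is a continuous equivariant map between $G$-flows, an extension is a surjective $G$-map, and a subflow is a nonempty closed $G$-invariant subset. An extension $\phi\colon Y\to W$ is $G$-irreducible if $\phi(C)\neq W$ for every proper subflow $C\subsetneq Y$. A $G$-projective cover of a $G$-flow $W$ is a $G$-irreducible extension $p\colon X\to W$ such that for every $G$-irreducible extension $\pi\colon Z\to W$ there is a $G$-map $\psi\colon X\to Z$ with $\pi\circ\psi=p$. An affine $G$-flow is a nonempty compact convex subset $K$ of a Hausdorff locally convex real topological vector space, with a jointly continuous action of $G$ on $K$ by affine homeomorphisms. Affine $G$-maps are continuous affine equivariant maps, affine extensions are surjective affine $G$-maps, and affine subflows are nonempty compact convex $G$-invariant subsets. An affine extension $\phi\colon K\to L$ is affine $G$-irreducible if $\phi(C)\ne L$ for every proper affine subflow $C\subsetneq K$. An affine $G$-flow $K$ is affine $G$-projective if for every affine $G$-map $\phi\colon K\to L$ and every affine extension $\pi\colon P\to L$ there is an affine $G$-map $\psi\colon K\to P$ with $\pi\circ\psi=\phi$. An affine $G$-projective cover of $K$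 is a pair $(L,\psi)$ where $L$ is an affine $G$-projective affine $G$-flow and $\psi\colon L\to K$ is an affine $G$-irreducible extension. For a $G$-flow $X$, $P(X)$ denotes the affine $G$-flow of regular Borel probability measures on $X$, viewed in $C(X)^*$ with the weak-$*$ topology and with $G$ acting by push-forward; $\delta_x$ is the Dirac mass at $x$. **Theorem.** Let $K$ be an affine $G$-flow, let $\overline{\operatorname{ext}}(K)$ be the closure of its set of extreme points (a $G$-flow), and let $p\colon X\to\overline{\operatorname{ext}}(K)$ be a $G$-projective cover of it. Then there is an affine extension $\phi\colon P(X)\to K$ with $\phi(\delta_x)=p(x)$ for all $x\in X$, such that there exists an affine subflow $L\subseteq P(X)$ minimal (under inclusion) among the affine subflows $C$ of $P(X)$ with $\phi(C)=K$, and for every such minimal $L$: 1. $(L,\phi|_L)$ is an affine $G$-projective cover of $K$; 2. it is the affine $G$-projective cover of $K$ up to isomorphism: for every affine $G$-projective cover $(M,\psi)$ of $K$ there is a bijective affine $G$-map $e\colon L\to M$ with $\psi\circ e=\phi|_L$. -/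

import Mathlib

open MeasureTheory Set

universe u

/-! ### Flows -/

/-- A `G`-flow: a nonempty compact Hausdorff space with a (jointly) continuous action of `G`. -/
structure GFlow (G : Type u) [Group G] [TopologicalSpace G] : Type (u + 1) where
  carrier : Type u
  [top : TopologicalSpace carrier]
  [compact : CompactSpace carrier]
  [t2 : T2Space carrier]
  [nonempty : Nonempty carrier]
  [action : MulAction G carrier]
  [continuous_action : ContinuousSMul G carrier]

namespace GFlow

instance (G : Type u) [Group G] [TopologicalSpace G] : CoeSort (GFlow G) (Type u) :=
  ⟨GFlow.carrier⟩

attribute [instance] GFlow.top GFlow.compact GFlow.t2 GFlow.nonempty GFlow.action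
  GFlow.continuous_action

variable {G : Type u} [Group G] [TopologicalSpace G]

/-- `G`-maps: continuous equivariant maps. -/
def IsGMap {X Y : GFlow G} (φ : X → Y) : Prop :=
  Continuous φ ∧ ∀ (g : G) (x : X), φ (g • x) = g • φ x

/-- Extensions: surjective `G`-maps. -/
def IsExtension {X Y : GFlow G} (φ : X → Y) : Prop :=
  IsGMap φ ∧ Function.Surjective φ

/-- Subflows: nonempty closed invariant subsets. -/
def IsSubflow (X : GFlow G) (C : Set X) : Prop :=
  C.Nonempty ∧ IsClosed C ∧ ∀ (g : G), ∀ x ∈ C, g • x ∈ C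

/-- `G`-irreducible extensions: no proper subflow is mapped onto the whole codomain. -/
def IsGIrreducible {X Y : GFlow G} (φ : X → Y) : Prop :=
  IsExtension φ ∧ ∀ C : Set X, X.IsSubflow C → C ≠ univ → φ '' C ≠ univ

/-- `(Y, φ)` is a `G`-projective cover of `X`: `φ : Y → X` is a `G`-irreducible extension which
factors through every `G`-irreducible extension of `X`. -/
def IsGProjectiveCover {Y X : GFlow G} (φ : Y → X) : Prop :=
  IsGIrreducible φ ∧
    ∀ (Z : GFlow G) (π : Z → X), IsGIrreducible π → ∃ ψ : Y → Z, IsGMap ψ ∧ π ∘ ψ = φ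

/-- A subflow, regarded as a flow. -/
def restrict (X : GFlow G) (C : Set X) (hC : X.IsSubflow C) : GFlow G :=
  letI : MulAction G C :=
    { smul := fun g x => ⟨g • (x : X), hC.2.2 g x x.2⟩
      one_smul := fun x => Subtype.ext (one_smul G (x : X))
      mul_smul := fun g h x => Subtype.ext (mul_smul g h (x : X)) }
  { carrier := C
    compact := isCompact_iff_compactSpace.mp hC.2.1.isCompact
    nonempty := hC.1.to_subtype
    continuous_action := ⟨Continuous.subtype_mk
      (continuous_fst.smul (continuous_subtype_val.comp continuous_snd)) _⟩ }

end GFlow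

/-! ### Affine flows -/

/-- An affine `G`-flow: a nonempty compact convex subset `carrier` of a Hausdorff locally convex
real topological vector space `E`, with a (jointly) continuous action of `G` on `carrier` by affine
maps (which are then affine homeomorphisms). -/
structure AffineFlow (G : Type u) [Group G] [TopologicalSpace G] : Type (u + 1) where
  E : Type u
  [addCommGroup : AddCommGroup E]
  [module : Module ℝ E]
  [top : TopologicalSpace E]
  [topAddGroup : IsTopologicalAddGroup E]
  [continuousSMul : ContinuousSMul ℝ E]
  [locallyConvex : LocallyConvexSpace ℝ E]
  [t2 : T2Space E]
  carrier : Set E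
  nonempty : carrier.Nonempty
  compact : IsCompact carrier
  convex : Convex ℝ carrier
  [action : MulAction G carrier]
  [continuous_action : ContinuousSMul G carrier]
  affine_action : ∀ (g : G) (x y z : carrier) (a b : ℝ), 0 ≤ a → 0 ≤ b → a + b = 1 →
    (z : E) = a • (x : E) + b • (y : E) →
    ((g • z : carrier) : E) = a • ((g • x : carrier) : E) + b • ((g • y : carrier) : E)

namespace AffineFlow

attribute [instance] AffineFlow.addCommGroup AffineFlow.module AffineFlow.top
  AffineFlow.topAddGroup AffineFlow.continuousSMul AffineFlow.locallyConvex AffineFlow.t2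
  AffineFlow.action AffineFlow.continuous_action

instance (G : Type u) [Group G] [TopologicalSpace G] : CoeSort (AffineFlow G) (Type u) :=
  ⟨fun K => K.carrier⟩

variable {G : Type u} [Group G] [TopologicalSpace G]

/-- The `G`-flow underlying an affine `G`-flow. -/
def toGFlow (K : AffineFlow G) : GFlow G where
  carrier := K.carrier
  compact := isCompact_iff_compactSpace.mp K.compact
  nonempty := K.nonempty.to_subtype

/-- Affine `G`-maps: continuous equivariant maps which preserve convex combinations. -/
def IsAffineGMap {K L : AffineFlow G} (φ : K → L) : Prop :=
  Continuous φ ∧ (∀ (g : G) (x : K), φ (g • x) = g • φ x) ∧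
    ∀ (x y z : K) (a b : ℝ), 0 ≤ a → 0 ≤ b → a + b = 1 →
      (z : K.E) = a • (x : K.E) + b • (y : K.E) →
      (φ z : L.E) = a • (φ x : L.E) + b • (φ y : L.E)

/-- Affine extensions: surjective affine `G`-maps. -/
def IsAffineExtension {K L : AffineFlow G} (φ : K → L) : Prop :=
  IsAffineGMap φ ∧ Function.Surjective φ

/-- Affine subflows: nonempty closed (equivalently, compact) convex invariant subsets. -/
def IsAffineSubflow (K : AffineFlow G) (C : Set K) : Prop :=
  C.Nonempty ∧ IsClosed C ∧ Convex ℝ (Subtype.val '' C : Set K.E) ∧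
    ∀ (g : G), ∀ x ∈ C, g • x ∈ C

/-- Affine `G`-irreducible extensions: no proper affine subflow is mapped onto the whole
codomain. -/
def IsAffineGIrreducible {K L : AffineFlow G} (φ : K → L) : Prop :=
  IsAffineExtension φ ∧ ∀ C : Set K, K.IsAffineSubflow C → C ≠ univ → φ '' C ≠ univ

/-- Affine `G`-projective flows: affine `G`-maps out of `K` lift along affine extensions. -/
def IsAffineGProjective (K : AffineFlow G) : Prop :=
  ∀ (L P : AffineFlow G) (φ : K → L) (π : P → L), IsAffineGMap φ → IsAffineExtension π →
    ∃ ψ : K → P, IsAffineGMap ψ ∧ π ∘ ψ = φ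

/-- `(L, ψ)` is an affine `G`-projective cover of `K`. -/
def IsAffineGProjectiveCover {L K : AffineFlow G} (ψ : L → K) : Prop :=
  L.IsAffineGProjective ∧ IsAffineGIrreducible ψ

/-- The inclusion of a subset of `K.carrier`, viewed in the ambient space, into `K`. -/
def ofImage (K : AffineFlow G) (C : Set K) (x : (Subtype.val '' C : Set K.E)) : K :=
  ⟨x, by obtain ⟨y, -, hy⟩ := x.2; exact hy ▸ y.2⟩

theorem ofImage_mem (K : AffineFlow G) (C : Set K) (x : (Subtype.val '' C : Set K.E)) :
    K.ofImage C x ∈ C := by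
  obtain ⟨_, y, hy, rfl⟩ := x
  exact hy

/-- The action of `G` on an affine subflow. -/
@[reducible] def restrictAction (K : AffineFlow G) (C : Set K) (hC : K.IsAffineSubflow C) :
    MulAction G (Subtype.val '' C : Set K.E) where
  smul g x := ⟨(g • K.ofImage C x : K), _, hC.2.2.2 g _ (K.ofImage_mem C x), rfl⟩
  one_smul x := by
    apply Subtype.ext
    have h := congrArg (fun y : K => (y : K.E)) (one_smul G (K.ofImage C x))
    exact h
  mul_smul g h x := by
    apply Subtype.ext
    have h' := congrArg (fun y : K => (y : K.E)) (mul_smul g h (K.ofImage C x))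
    exact h'

/-- An affine subflow, regarded as an affine flow in the same ambient space. -/
def restrict (K : AffineFlow G) (C : Set K) (hC : K.IsAffineSubflow C) : AffineFlow G where
  E := K.E
  carrier := Subtype.val '' C
  nonempty := hC.1.image _
  compact := by
    have := isCompact_iff_compactSpace.mp K.compact
    exact hC.2.1.isCompact.image continuous_subtype_val
  convex := hC.2.2.1
  action := K.restrictAction C hC
  continuous_action := by
    let _ := K.restrictAction C hC
    have h1 : Continuous (K.ofImage C) := Continuous.subtype_mk continuous_subtype_val _
    have h2 : Continuous fun p : G × (Subtype.val '' C : Set K.E) => p.1 • K.ofImage C p.2 :=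
      continuous_fst.smul (h1.comp continuous_snd)
    exact ⟨Continuous.subtype_mk (continuous_subtype_val.comp h2) _⟩
  affine_action := fun g x y z a b ha hb hab h =>
    K.affine_action g (K.ofImage C x) (K.ofImage C y) (K.ofImage C z) a b ha hb hab h

/-- The inclusion of an affine subflow. -/
def incl (K : AffineFlow G) (C : Set K) (hC : K.IsAffineSubflow C) (x : K.restrict C hC) : K :=
  K.ofImage C ⟨x.1, x.2⟩

/-! ### The closure of the set of extreme points -/

/-- The set `ext(K)` of extreme points of `K`. -/
def extPts (K : AffineFlow G) : Set K :=
  {x | (x : K.E) ∈ K.carrier.extremePoints ℝ}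

theorem smul_mem_extPts (K : AffineFlow G) (g : G) {x : K} (hx : x ∈ K.extPts) : g • x ∈ K.extPts := by
  refine mem_extremePoints.mpr ⟨(g • x).2, ?_⟩
  rintro y hy z hz ⟨a, b, ha, hb, hab, h⟩
  have key := K.affine_action g⁻¹ ⟨y, hy⟩ ⟨z, hz⟩ (g • x) a b ha.le hb.le hab h.symm
  rw [inv_smul_smul] at key
  have h2 := (mem_extremePoints.mp hx).2 _ (g⁻¹ • (⟨y, hy⟩ : K)).2 _ (g⁻¹ • (⟨z, hz⟩ : K)).2
    ⟨a, b, ha, hb, hab, key.symm⟩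
  have h3 : g⁻¹ • (⟨y, hy⟩ : K) = x := Subtype.ext h2.1
  have h4 : g⁻¹ • (⟨z, hz⟩ : K) = x := Subtype.ext h2.2
  exact ⟨congrArg Subtype.val (inv_smul_eq_iff.mp h3), congrArg Subtype.val (inv_smul_eq_iff.mp h4)⟩

theorem isSubflow_closure_extPts (K : AffineFlow G) : K.toGFlow.IsSubflow (closure K.extPts) := by
  refine ⟨?_, isClosed_closure, fun g x hx => ?_⟩
  · obtain ⟨x, hx⟩ := K.compact.extremePoints_nonempty K.nonempty
    exact ⟨⟨x, hx.1⟩, subset_closure hx⟩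
  · exact map_mem_closure (continuous_const_smul (T := K.toGFlow) g) hx
      fun y hy => K.smul_mem_extPts g hy

/-- The `G`-flow given by the closure of the set of extreme points of `K`. -/
def extClosure (K : AffineFlow G) : GFlow G :=
  K.toGFlow.restrict (closure K.extPts) K.isSubflow_closure_extPts

/-- The inclusion of the closure of `ext(K)` into `K`. -/
def extIncl (K : AffineFlow G) (x : K.extClosure) : K :=
  Subtype.val (p := fun y : K => y ∈ closure K.extPts) x

end AffineFlow

/-! ### The affine flow of regular Borel probability measures -/

/-- `P(X)` inside the weak-* dual of `C(X)`: the functionals of the form `f ↦ ∫ f dμ`, where `μ`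
is a regular Borel probability measure on `X`. -/
def probMeasures (X : Type u) [TopologicalSpace X] [CompactSpace X] :
    Set (WeakDual ℝ C(X, ℝ)) :=
  letI : MeasurableSpace X := borel X
  {Λ | ∃ μ : Measure X, IsProbabilityMeasure μ ∧ μ.Regular ∧ ∀ f : C(X, ℝ), Λ f = ∫ x, f x ∂μ}

section ProbMeasures

variable {X : Type u} [TopologicalSpace X] [CompactSpace X]

theorem mem_probMeasures_iff [T2Space X] (Λ : WeakDual ℝ C(X, ℝ)) :
    Λ ∈ probMeasures X ↔ (∀ f : C(X, ℝ), 0 ≤ f → 0 ≤ Λ f) ∧ Λ 1 = 1 := by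
  let _ : MeasurableSpace X := borel X
  have : BorelSpace X := ⟨rfl⟩
  constructor
  · rintro ⟨μ, hμ, -, h⟩
    refine ⟨fun f hf => ?_, ?_⟩
    · rw [h]
      exact integral_nonneg fun x => hf x
    · rw [h]
      simp
  · rintro ⟨hpos, h1⟩
    let Λ' : CompactlySupportedContinuousMap X ℝ →ₚ[ℝ] ℝ :=
      PositiveLinearMap.mk₀
        { toFun := fun f => Λ (f : C(X, ℝ))
          map_add' := fun f g => map_add Λ (f : C(X, ℝ)) (g : C(X, ℝ))
          map_smul' := fun c f => map_smul Λ c (f : C(X, ℝ)) }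
        (fun f hf => hpos f hf)
    have key : ∀ f : C(X, ℝ), Λ f = ∫ x, f x ∂(RealRMK.rieszMeasure Λ') := fun f =>
      (RealRMK.integral_rieszMeasure Λ'
        (CompactlySupportedContinuousMap.continuousMapEquiv f)).symm
    refine ⟨RealRMK.rieszMeasure Λ', ⟨?_⟩, inferInstance, key⟩
    have h := key 1
    rw [h1] at h
    simp only [ContinuousMap.one_apply, integral_const, smul_eq_mul, mul_one] at h
    rw [measureReal_def] at h
    rw [← ENNReal.toReal_eq_one_iff, ← h]

theorem norm_apply_le_of_mem_probMeasures [T2Space X] {Λ : WeakDual ℝ C(X, ℝ)}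
    (hΛ : Λ ∈ probMeasures X) (f : C(X, ℝ)) : ‖Λ f‖ ≤ ‖f‖ := by
  rw [mem_probMeasures_iff] at hΛ
  have hle : ∀ f : C(X, ℝ), Λ f ≤ ‖f‖ := fun f => by
    have h := hΛ.1 (‖f‖ • 1 - f) (fun x => by
      simpa using (le_abs_self (f x)).trans (f.norm_coe_le_norm x))
    rw [map_sub, map_smul, hΛ.2, smul_eq_mul, mul_one] at h
    linarith
  rw [Real.norm_eq_abs, abs_le]
  have h1 := hle f
  have h2 := hle (-f)
  rw [map_neg, norm_neg] at h2
  exact ⟨by linarith, h1⟩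

theorem isCompact_probMeasures [T2Space X] : IsCompact (probMeasures X) := by
  have hset : probMeasures X = {Λ : WeakDual ℝ C(X, ℝ) | (∀ f : C(X, ℝ), 0 ≤ f → 0 ≤ Λ f) ∧
      Λ 1 = 1} := ext fun Λ => mem_probMeasures_iff Λ
  refine (WeakDual.isCompact_closedBall (0 : StrongDual ℝ C(X, ℝ)) 1).of_isClosed_subset ?_ ?_
  · rw [hset]
    simp only [ofPred_and, ofPred_forall]
    refine IsClosed.inter (isClosed_iInter fun f => isClosed_iInter fun _ => ?_) ?_
    · exact isClosed_le continuous_const (WeakDual.eval_continuous f)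
    · exact isClosed_eq (WeakDual.eval_continuous 1) continuous_const
  · intro Λ hΛ
    simp only [mem_preimage, Metric.mem_closedBall, dist_zero_right]
    refine ContinuousLinearMap.opNorm_le_bound _ zero_le_one fun f => ?_
    rw [one_mul]
    exact norm_apply_le_of_mem_probMeasures hΛ f

theorem convex_probMeasures [T2Space X] : Convex ℝ (probMeasures X) := by
  intro Λ hΛ Λ' hΛ' a b ha hb hab
  rw [mem_probMeasures_iff] at *
  refine ⟨fun f hf => ?_, ?_⟩
  · exact add_nonneg (mul_nonneg ha (hΛ.1 f hf)) (mul_nonneg hb (hΛ'.1 f hf))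
  · change a * Λ 1 + b * Λ' 1 = 1
    rw [hΛ.2, hΛ'.2, mul_one, mul_one, hab]

/-- The Dirac mass at `x`, i.e. the functional `f ↦ f x`. -/
noncomputable def diracFunctional (x : X) : WeakDual ℝ C(X, ℝ) :=
  StrongDual.toWeakDual (ContinuousMap.evalCLM ℝ x)

theorem diracFunctional_mem [T2Space X] (x : X) : diracFunctional x ∈ probMeasures X := by
  rw [mem_probMeasures_iff]
  exact ⟨fun f hf => hf x, rfl⟩

/-- Push-forward of functionals along `h : X → Y`, namely `f ↦ Λ (f ∘ h)`. On integration
functionals this is the push-forward of measures, as `∫ f d(h_* μ) = ∫ f ∘ h dμ`. -/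
noncomputable def pushFunctional {Y : Type u} [TopologicalSpace Y] [CompactSpace Y] (h : C(X, Y))
    (Λ : WeakDual ℝ C(X, ℝ)) : WeakDual ℝ C(Y, ℝ) :=
  StrongDual.toWeakDual ((WeakDual.toStrongDual Λ).comp (h.compCLM ℝ ℝ))

theorem pushFunctional_mem [T2Space X] {Y : Type u} [TopologicalSpace Y] [CompactSpace Y]
    [T2Space Y] (h : C(X, Y)) {Λ : WeakDual ℝ C(X, ℝ)} (hΛ : Λ ∈ probMeasures X) :
    pushFunctional h Λ ∈ probMeasures Y := by
  rw [mem_probMeasures_iff] at *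
  exact ⟨fun f hf => hΛ.1 (f.comp h) fun x => hf (h x), hΛ.2⟩

end ProbMeasures

namespace GFlow

variable {G : Type u} [Group G] [TopologicalSpace G]

/-- Translation by `g`, as a continuous map. -/
def translate (X : GFlow G) (g : G) : C(X, X) :=
  ⟨fun x => g • x, continuous_const_smul g⟩

/-- The action of `G` on `P(X)` by push-forward: `(g • Λ) f = Λ (x ↦ f (g • x))`. -/
@[reducible] noncomputable def probAction (X : GFlow G) : MulAction G (probMeasures X) where
  smul g Λ := ⟨pushFunctional (X.translate g) Λ, pushFunctional_mem _ Λ.2⟩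
  one_smul Λ := by
    apply Subtype.ext
    refine DFunLike.ext _ _ fun f => congrArg (Λ : WeakDual ℝ C(X, ℝ)) ?_
    ext x
    exact congrArg f (one_smul G x)
  mul_smul g h Λ := by
    apply Subtype.ext
    refine DFunLike.ext _ _ fun f => congrArg (Λ : WeakDual ℝ C(X, ℝ)) ?_
    ext x
    exact congrArg f (mul_smul g h x)

/-- The affine `G`-flow `P(X)` of regular Borel probability measures on `X`. -/
noncomputable def prob (X : GFlow G) : AffineFlow G where
  E := WeakDual ℝ C(X, ℝ)
  locallyConvex := inferInstanceAs
    (LocallyConvexSpace ℝ (WeakBilin (topDualPairing ℝ C(X, ℝ))))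
  carrier := probMeasures X
  nonempty := ⟨_, diracFunctional_mem (Classical.arbitrary X)⟩
  compact := isCompact_probMeasures
  convex := convex_probMeasures
  action := X.probAction
  continuous_action := by
    let _ := X.probAction
    refine ⟨Continuous.subtype_mk (WeakDual.continuous_of_continuous_eval fun f => ?_) _⟩
    let F : C(G, C(X, ℝ)) :=
      ContinuousMap.curry ⟨fun p : G × X => f (p.1 • p.2), f.continuous.comp continuous_smul⟩
    change Continuous fun p : G × probMeasures X => (p.2 : WeakDual ℝ C(X, ℝ)) (F p.1)
    refine continuous_iff_continuousAt.mpr fun p₀ => ?_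
    have h1 : Continuous fun p : G × probMeasures X =>
        (p.2 : WeakDual ℝ C(X, ℝ)) (F p₀.1) :=
      (WeakDual.eval_continuous (F p₀.1)).comp (continuous_subtype_val.comp continuous_snd)
    have h2 : Filter.Tendsto (fun p : G × probMeasures X => ‖F p.1 - F p₀.1‖) (nhds p₀)
        (nhds 0) := by
      have h : Continuous fun p : G × probMeasures X => ‖F p.1 - F p₀.1‖ :=
        ((F.continuous.comp continuous_fst).sub continuous_const).norm
      simpa using h.tendsto p₀
    have h3 : Filter.Tendsto (fun p : G × probMeasures X =>
        (p.2 : WeakDual ℝ C(X, ℝ)) (F p.1 - F p₀.1)) (nhds p₀) (nhds 0) :=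
      squeeze_zero_norm (fun p => norm_apply_le_of_mem_probMeasures p.2.2 _) h2
    have h4 := h3.add (h1.tendsto p₀)
    rw [zero_add] at h4
    refine h4.congr fun p => ?_
    rw [map_sub, sub_add_cancel]
  affine_action := fun g x y z a b _ _ _ h => by
    change pushFunctional (X.translate g) (z : WeakDual ℝ C(X, ℝ)) = _
    rw [h]
    rfl

/-- The point of `P(X)` given by the Dirac mass at `x`. -/
noncomputable def dirac (X : GFlow G) (x : X) : X.prob :=
  ⟨diracFunctional x, diracFunctional_mem x⟩

end GFlow

/-! A `G`-map from `X` to an affine flow extends to `P(X)` by taking barycenters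
(`IsGMap.exists_extend_prob`). Applied to `p` followed by the inclusion into `K`, this gives `φ`,
which is onto by Krein–Milman. Zorn's lemma provides minimal `L`, and minimality makes `φ`
irreducible on `L`.

Everything else rests on a rigidity statement, `IsAffineGIrreducible.eq_of_comp_eq`: between
irreducible affine extensions of `K` there is at most one affine `G`-map over `K`. Irreducibility
makes the midpoint of two such maps onto, and a preimage of an extreme point under the midpoint is a
point where the two maps agree.

For projectivity, given `θ : L → Q` and an affine extension `π : P → Q`, the fibre product of `L`
and `P` over `Q` is a `G`-flow mapping onto `K`, so `p` lifts to it. The two coordinates of the lift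
extend to affine maps `β₁`, `β₂` on `P(X)` with `π ∘ β₂ = θ ∘ β₁`. On `L` the map `β₁` is an
endomorphism over `K`, hence the identity by rigidity, and `β₂` restricted to `L` lifts `θ`.
Uniqueness of the cover follows from projectivity and rigidity. -/

section Minimal

/-! ### Zorn's lemma for closed sets mapped onto the codomain -/

variable {X Y : Type*} [TopologicalSpace X] [CompactSpace X] [TopologicalSpace Y] [T1Space Y]

/-- A chain of closed sets, each mapped onto the codomain by a continuous map from a compact space,
has an intersection which is mapped onto the codomain. -/
theorem image_sInter_eq_univ_of_isChain {f : X → Y} (hf : Continuous f) {c : Set (Set X)}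
    (hc : IsChain (· ⊆ ·) c) (hne : c.Nonempty) (hcl : ∀ C ∈ c, IsClosed C)
    (him : ∀ C ∈ c, f '' C = univ) : f '' (⋂₀ c) = univ := by
  refine eq_univ_of_forall fun y => ?_
  have : Nonempty c := hne.to_subtype
  have hfib : IsClosed (f ⁻¹' {y}) := isClosed_singleton.preimage hf
  -- The traces of the chain on the fibre over `y` are nonempty, compact and directed, so they have
  -- a common point.
  obtain ⟨x, hx⟩ := IsCompact.nonempty_iInter_of_directed_nonempty_isCompact_isClosed
    (fun C : c => (C : Set X) ∩ f ⁻¹' {y})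
    (fun C D => by
      rcases hc.total C.2 D.2 with h | h
      · exact ⟨C, subset_rfl, inter_subset_inter_left _ h⟩
      · exact ⟨D, inter_subset_inter_left _ h, subset_rfl⟩)
    (fun C => by
      obtain ⟨x, hx, rfl⟩ := (him C C.2).ge (mem_univ y)
      exact ⟨x, hx, rfl⟩)
    (fun C => ((hcl C C.2).inter hfib).isCompact)
    (fun C => (hcl C C.2).inter hfib)
  rw [mem_iInter] at hx
  exact ⟨x, mem_sInter.2 fun C hC => (hx ⟨C, hC⟩).1, (hx ⟨_, hne.some_mem⟩).2⟩

/-- A family of closed sets which is stable under intersections of nonempty chains and contains the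
whole space has a minimal member among those mapped onto the codomain. -/
theorem exists_minimal_image_eq_univ {f : X → Y} (hf : Continuous f)
    (hsurj : Function.Surjective f) (Q : Set X → Prop) (huniv : Q univ)
    (hcl : ∀ C, Q C → IsClosed C)
    (hQ : ∀ c : Set (Set X), c.Nonempty → (∀ C ∈ c, Q C) → f '' (⋂₀ c) = univ → Q (⋂₀ c)) :
    ∃ C, Minimal (fun C => Q C ∧ f '' C = univ) C := by
  refine zorn_superset {C | Q C ∧ f '' C = univ} fun c hc hchain => ?_
  rcases c.eq_empty_or_nonempty with rfl | hne
  · exact ⟨univ, ⟨huniv, image_univ_of_surjective hsurj⟩, by simp⟩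
  · have h := image_sInter_eq_univ_of_isChain hf hchain hne (fun C hC => hcl C (hc hC).1)
      fun C hC => (hc hC).2
    exact ⟨⋂₀ c, ⟨hQ c hne (fun C hC => (hc hC).1) h, h⟩, fun C hC => sInter_subset_of_mem hC⟩

end Minimal

/-! ### Subflows and lifting from projective covers -/

namespace GFlow

variable {G : Type u} [Group G] [TopologicalSpace G]

theorem IsGMap.comp {X Y Z : GFlow G} {g : Y → Z} {f : X → Y} (hg : IsGMap g) (hf : IsGMap f) :
    IsGMap (g ∘ f) :=
  ⟨hg.1.comp hf.1, fun a x => by simp only [Function.comp_apply, hf.2, hg.2]⟩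

/-- The inclusion of a subflow. -/
def restrictIncl (X : GFlow G) (C : Set X) (hC : X.IsSubflow C) (x : X.restrict C hC) : X :=
  Subtype.val (p := fun y : X => y ∈ C) x

theorem isGMap_restrictIncl (X : GFlow G) (C : Set X) (hC : X.IsSubflow C) :
    IsGMap (X.restrictIncl C hC) :=
  ⟨continuous_subtype_val, fun _ _ => rfl⟩

theorem range_restrictIncl (X : GFlow G) (C : Set X) (hC : X.IsSubflow C) :
    range (X.restrictIncl C hC) = C :=
  Subtype.range_val

theorem isSubflow_univ (X : GFlow G) : X.IsSubflow univ :=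
  ⟨univ_nonempty, isClosed_univ, fun _ _ _ => mem_univ _⟩

theorem IsSubflow.image {X Y : GFlow G} {f : X → Y} (hf : IsGMap f) {C : Set X}
    (hC : X.IsSubflow C) : Y.IsSubflow (f '' C) := by
  refine ⟨hC.1.image f, (hC.2.1.isCompact.image hf.1).isClosed, ?_⟩
  rintro g _ ⟨x, hx, rfl⟩
  exact ⟨g • x, hC.2.2 g x hx, hf.2 g x⟩

/-- Every extension restricts to an irreducible extension on some subflow. -/
theorem IsExtension.exists_isGIrreducible_restrict {Z W : GFlow G} {π : Z → W}
    (hπ : IsExtension π) :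
    ∃ (C : Set Z) (hC : Z.IsSubflow C), IsGIrreducible (π ∘ Z.restrictIncl C hC) := by
  obtain ⟨C, ⟨hC, him⟩, hmin⟩ := exists_minimal_image_eq_univ hπ.1.1 hπ.2 Z.IsSubflow
    Z.isSubflow_univ (fun C hC => hC.2.1) (fun c hne hc h =>
      ⟨Set.Nonempty.of_image (f := π) (h ▸ univ_nonempty), isClosed_sInter fun C hC => (hc C hC).2.1,
        fun g x hx => mem_sInter.2 fun C hC => (hc C hC).2.2 g x (hx C hC)⟩)
  refine ⟨C, hC, ⟨hπ.1.comp (Z.isGMap_restrictIncl C hC), ?_⟩, fun D hD hDne h => hDne ?_⟩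
  · rw [← range_eq_univ, range_comp, range_restrictIncl, him]
  · rw [image_comp] at h
    have hsub : Z.restrictIncl C hC '' D ⊆ C :=
      (image_subset_range _ _).trans (Z.range_restrictIncl C hC).le
    -- A subflow of the restricted flow is also one of `Z`, so minimality of `C` applies to it.
    have hle := hmin ⟨hD.image (Z.isGMap_restrictIncl C hC), h⟩ hsub
    refine eq_univ_of_forall fun x => ?_
    obtain ⟨y, hy, hyx⟩ := hle (Subtype.prop (p := fun y : Z => y ∈ C) x)
    rwa [← Subtype.val_injective (p := fun y : Z => y ∈ C) hyx]

/-- A projective cover factors through every extension, not only the irreducible ones. -/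
theorem IsGProjectiveCover.exists_lift {X W Z : GFlow G} {p : X → W} (hp : IsGProjectiveCover p)
    {π : Z → W} (hπ : IsExtension π) : ∃ ψ : X → Z, IsGMap ψ ∧ π ∘ ψ = p := by
  obtain ⟨C, hC, hirr⟩ := hπ.exists_isGIrreducible_restrict
  obtain ⟨ψ, hψ, h⟩ := hp.2 _ _ hirr
  exact ⟨Z.restrictIncl C hC ∘ ψ, (Z.isGMap_restrictIncl C hC).comp hψ, h⟩

/-- The product of two flows. -/
def prod (X Y : GFlow G) : GFlow G where
  carrier := X × Y

end GFlow

namespace AffineFlow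

variable {G : Type u} [Group G] [TopologicalSpace G]

instance (K : AffineFlow G) : CompactSpace K := K.toGFlow.compact

instance (K : AffineFlow G) : Nonempty K := K.toGFlow.nonempty

theorem isGMap_extIncl (K : AffineFlow G) :
    GFlow.IsGMap (X := K.extClosure) (Y := K.toGFlow) K.extIncl :=
  K.toGFlow.isGMap_restrictIncl _ K.isSubflow_closure_extPts

/-- A projective cover of the closure of the extreme points of `K` lifts along every `G`-map to `K`
which hits all extreme points. -/
theorem exists_lift_extIncl {K : AffineFlow G} {X : GFlow G} {p : X → K.extClosure}
    (hp : GFlow.IsGProjectiveCover p) {Y : GFlow G} {τ : Y → K.toGFlow} (hτ : GFlow.IsGMap τ)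
    (hext : K.extPts ⊆ range τ) :
    ∃ ψ : X → Y, GFlow.IsGMap ψ ∧ ∀ x, τ (ψ x) = K.extIncl (p x) := by
  have hcl : closure K.extPts ⊆ range τ :=
    closure_minimal hext (isCompact_range hτ.1).isClosed
  -- Over the closure of the extreme points, `τ` becomes an extension, through which `p` factors.
  have hS : Y.IsSubflow (τ ⁻¹' closure K.extPts) := by
    refine ⟨?_, isClosed_closure.preimage hτ.1, fun g y hy => ?_⟩
    · obtain ⟨x, hx⟩ := K.isSubflow_closure_extPts.1
      obtain ⟨y, rfl⟩ := hcl hx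
      exact ⟨y, hx⟩
    · rw [mem_preimage, hτ.2]
      exact K.isSubflow_closure_extPts.2.2 g _ hy
  let π : Y.restrict _ hS → K.extClosure := fun y => Subtype.mk (τ y.1) y.2
  have hπ : GFlow.IsExtension π := by
    refine ⟨⟨Continuous.subtype_mk (hτ.1.comp continuous_subtype_val) _,
      fun g y => Subtype.ext (hτ.2 g _)⟩, fun w => ?_⟩
    obtain ⟨y, hy⟩ := hcl (Subtype.prop (p := fun y : K => y ∈ closure K.extPts) w)
    refine ⟨⟨y, ?_⟩, Subtype.ext hy⟩
    rw [mem_preimage, hy]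
    exact Subtype.prop (p := fun y : K => y ∈ closure K.extPts) w
  obtain ⟨ψ, hψ, h⟩ := hp.exists_lift hπ
  exact ⟨Y.restrictIncl _ hS ∘ ψ, (Y.isGMap_restrictIncl _ hS).comp hψ,
    fun x => congrArg K.extIncl (congrFun h x)⟩

/-! ### Affine maps and convex subsets -/

/-- Maps preserving convex combinations. -/
def PreservesCombos {K L : AffineFlow G} (φ : K → L) : Prop :=
  ∀ (x y z : K) (a b : ℝ), 0 ≤ a → 0 ≤ b → a + b = 1 →
    (z : K.E) = a • (x : K.E) + b • (y : K.E) →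
    (φ z : L.E) = a • (φ x : L.E) + b • (φ y : L.E)

theorem PreservesCombos.comp {K L M : AffineFlow G} {g : L → M} {f : K → L}
    (hg : PreservesCombos g) (hf : PreservesCombos f) : PreservesCombos (g ∘ f) :=
  fun x y z a b ha hb hab h => hg _ _ _ a b ha hb hab (hf x y z a b ha hb hab h)

theorem IsAffineGMap.comp {K L M : AffineFlow G} {g : L → M} {f : K → L}
    (hg : IsAffineGMap g) (hf : IsAffineGMap f) : IsAffineGMap (g ∘ f) :=
  ⟨hg.1.comp hf.1, fun a x => by simp only [Function.comp_apply, hf.2.1, hg.2.1],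
    PreservesCombos.comp hg.2.2 hf.2.2⟩

theorem isAffineGMap_id (K : AffineFlow G) : IsAffineGMap (id : K → K) :=
  ⟨continuous_id, fun _ _ => rfl, fun _ _ _ _ _ _ _ _ h => h⟩

theorem preservesCombos_smul (K : AffineFlow G) (g : G) :
    PreservesCombos (fun x : K => g • x) :=
  K.affine_action g

/-- Convex combinations of points of `K`. -/
def combo (K : AffineFlow G) (x y : K) {a b : ℝ} (ha : 0 ≤ a) (hb : 0 ≤ b) (hab : a + b = 1) : K :=
  ⟨a • (x : K.E) + b • (y : K.E), K.convex x.2 y.2 ha hb hab⟩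

/-- Convexity is defined in the ambient space; this moves it to points of `K`, where affine maps are
defined. -/
theorem convex_image_val_iff {K : AffineFlow G} {C : Set K} :
    Convex ℝ (Subtype.val '' C : Set K.E) ↔ ∀ x ∈ C, ∀ y ∈ C, ∀ (z : K) (a b : ℝ), 0 ≤ a → 0 ≤ b →
      a + b = 1 → (z : K.E) = a • (x : K.E) + b • (y : K.E) → z ∈ C := by
  constructor
  · intro h x hx y hy z a b ha hb hab hz
    obtain ⟨w, hw, hwz⟩ := h (mem_image_of_mem _ hx) (mem_image_of_mem _ hy) ha hb hab
    rw [← hz] at hwz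
    exact Subtype.ext hwz ▸ hw
  · rintro h _ ⟨x, hx, rfl⟩ _ ⟨y, hy, rfl⟩ a b ha hb hab
    exact ⟨K.combo x y ha hb hab, h x hx y hy _ a b ha hb hab rfl, rfl⟩

theorem PreservesCombos.convex_image {K L : AffineFlow G} {φ : K → L} (hφ : PreservesCombos φ)
    {C : Set K} (hC : Convex ℝ (Subtype.val '' C : Set K.E)) :
    Convex ℝ (Subtype.val '' (φ '' C) : Set L.E) := by
  rw [convex_image_val_iff] at hC ⊢
  rintro _ ⟨x, hx, rfl⟩ _ ⟨y, hy, rfl⟩ z a b ha hb hab hz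
  refine ⟨K.combo x y ha hb hab, hC x hx y hy _ a b ha hb hab rfl, Subtype.ext ?_⟩
  rw [hz, hφ x y _ a b ha hb hab rfl]

theorem PreservesCombos.convex_eqLocus {K L : AffineFlow G} {φ ψ : K → L}
    (hφ : PreservesCombos φ) (hψ : PreservesCombos ψ) :
    Convex ℝ (Subtype.val '' {x | φ x = ψ x} : Set K.E) := by
  rw [convex_image_val_iff]
  intro x hx y hy z a b ha hb hab hz
  apply Subtype.ext
  rw [hφ x y z a b ha hb hab hz, hψ x y z a b ha hb hab hz, hx, hy]

theorem convex_image_val_univ (K : AffineFlow G) :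
    Convex ℝ (Subtype.val '' (univ : Set K) : Set K.E) :=
  convex_image_val_iff.2 fun _ _ _ _ _ _ _ _ _ _ _ => mem_univ _

theorem isAffineSubflow_univ (K : AffineFlow G) : K.IsAffineSubflow univ :=
  ⟨univ_nonempty, isClosed_univ, K.convex_image_val_univ, fun _ _ _ => mem_univ _⟩

theorem IsAffineSubflow.image {K L : AffineFlow G} {f : K → L} (hf : IsAffineGMap f) {C : Set K}
    (hC : K.IsAffineSubflow C) : L.IsAffineSubflow (f '' C) := by
  refine ⟨hC.1.image f, (hC.2.1.isCompact.image hf.1).isClosed,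
    PreservesCombos.convex_image hf.2.2 hC.2.2.1, ?_⟩
  rintro g _ ⟨x, hx, rfl⟩
  exact ⟨g • x, hC.2.2.2 g x hx, hf.2.1 g x⟩

/-! ### Krein–Milman and rigidity over the base -/

/-- **Krein–Milman** for affine flows. -/
theorem eq_univ_of_extPts_subset {K : AffineFlow G} {C : Set K} (hcl : IsClosed C)
    (hconv : Convex ℝ (Subtype.val '' C : Set K.E)) (hext : K.extPts ⊆ C) : C = univ := by
  have h : K.carrier ⊆ Subtype.val '' C := by
    conv_lhs => rw [← closure_convexHull_extremePoints K.compact K.convex]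
    refine closure_minimal (convexHull_min (fun x hx => ?_) hconv)
      (hcl.isCompact.image continuous_subtype_val).isClosed
    exact ⟨⟨x, hx.1⟩, hext hx, rfl⟩
  refine eq_univ_of_forall fun x => ?_
  obtain ⟨y, hy, hyx⟩ := h x.2
  exact Subtype.ext hyx ▸ hy

/-- Two affine `G`-maps between irreducible extensions of `K` which are maps over `K` agree. -/
theorem IsAffineGIrreducible.eq_of_comp_eq {K L M : AffineFlow G} {ρ : M → K} {φ : L → K}
    (hρ : IsAffineGIrreducible ρ) (hφ : IsAffineGIrreducible φ) {f g : M → L}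
    (hf : IsAffineGMap f) (hg : IsAffineGMap g) (hfρ : φ ∘ f = ρ) (hgρ : φ ∘ g = ρ) : f = g := by
  have h0 : (0 : ℝ) ≤ 1 / 2 := by norm_num
  have h1 : (1 / 2 + 1 / 2 : ℝ) = 1 := by norm_num
  -- The midpoint of `f` and `g` is again an affine `G`-map over `K`.
  let h : M → L := fun m => L.combo (f m) (g m) h0 h0 h1
  have hh : IsAffineGMap h := by
    refine ⟨Continuous.subtype_mk (((continuous_subtype_val.comp hf.1).const_smul _).add
      ((continuous_subtype_val.comp hg.1).const_smul _)) _, fun a x => Subtype.ext ?_, ?_⟩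
    · rw [L.affine_action a (f x) (g x) (h x) _ _ h0 h0 h1 rfl, ← hf.2.1, ← hg.2.1]
      rfl
    · intro x y z a b ha hb hab hz
      change (1 / 2 : ℝ) • (f z : L.E) + (1 / 2 : ℝ) • (g z : L.E) =
        a • ((1 / 2 : ℝ) • (f x : L.E) + (1 / 2 : ℝ) • (g x : L.E)) +
        b • ((1 / 2 : ℝ) • (f y : L.E) + (1 / 2 : ℝ) • (g y : L.E))
      rw [hf.2.2 x y z a b ha hb hab hz, hg.2.2 x y z a b ha hb hab hz]
      module
  have hhρ : φ ∘ h = ρ := by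
    funext m
    apply Subtype.ext
    have h2 := hφ.1.1.2.2 (f m) (g m) (h m) _ _ h0 h0 h1 rfl
    have h3 : φ (f m) = ρ m := congrFun hfρ m
    have h4 : φ (g m) = ρ m := congrFun hgρ m
    rw [Function.comp_apply, h2, h3, h4, ← add_smul, h1, one_smul]
  -- The image of `h` is an affine subflow mapped onto `K`, so irreducibility of `φ` applies.
  have hsurj : ∀ e : L, ∃ m, h m = e := by
    have himg : h '' univ = univ := by
      by_contra hne
      refine hφ.2 _ (M.isAffineSubflow_univ.image hh) hne ?_
      rw [← image_comp, hhρ, image_univ_of_surjective hρ.1.2]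
    intro e
    obtain ⟨m, -, hm⟩ := himg.ge (mem_univ e)
    exact ⟨m, hm⟩
  have hext : ∀ e ∈ L.extPts, ∃ m, f m = e ∧ g m = e := by
    intro e he
    obtain ⟨m, rfl⟩ := hsurj e
    have := (mem_extremePoints.mp he).2 _ (f m).2 _ (g m).2
      ⟨1 / 2, 1 / 2, by norm_num, by norm_num, h1, rfl⟩
    exact ⟨m, Subtype.ext this.1, Subtype.ext this.2⟩
  have hcl : IsClosed {m | f m = g m} := isClosed_eq hf.1 hg.1
  have hconv : Convex ℝ (Subtype.val '' {m | f m = g m} : Set M.E) :=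
    PreservesCombos.convex_eqLocus hf.2.2 hg.2.2
  -- The image of the equalizer is closed and convex and contains the extreme points of `L`.
  have himg : f '' {m | f m = g m} = univ := by
    refine eq_univ_of_extPts_subset (hcl.isCompact.image hf.1).isClosed
      (PreservesCombos.convex_image hf.2.2 hconv) fun e he => ?_
    obtain ⟨m, hfm, hgm⟩ := hext e he
    exact ⟨m, hfm.trans hgm.symm, hfm⟩
  -- The equalizer is now an affine subflow that `ρ = φ ∘ f` maps onto `K`; irreducibility of `ρ`
  -- forbids it to be proper.
  by_contra hne
  refine hρ.2 {m | f m = g m} ⟨?_, hcl, hconv, fun a m hm => ?_⟩ ?_ ?_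
  · exact Set.Nonempty.of_image (f := f) (himg ▸ univ_nonempty)
  · change f (a • m) = g (a • m)
    rw [hf.2.1, hg.2.1, show f m = g m from hm]
  · exact fun h => hne (funext fun m => h.ge (mem_univ m))
  · rw [← hfρ, image_comp, himg, image_univ_of_surjective hφ.1.2]

/-! ### Minimal affine subflows and uniqueness of covers -/

/-- Closedness, convexity and invariance pass to intersections; the intersection of a chain is
nonempty because its image is. -/
theorem IsAffineExtension.exists_minimal {K L : AffineFlow G} {φ : K → L}
    (hφ : IsAffineExtension φ) :
    ∃ C : Set K, Minimal (fun C : Set K => K.IsAffineSubflow C ∧ φ '' C = univ) C := by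
  refine exists_minimal_image_eq_univ hφ.1.1 hφ.2 K.IsAffineSubflow K.isAffineSubflow_univ
    (fun C hC => hC.2.1) fun c hne hc h => ⟨Set.Nonempty.of_image (f := φ) (h ▸ univ_nonempty),
      isClosed_sInter fun C hC => (hc C hC).2.1, ?_,
      fun g x hx => mem_sInter.2 fun C hC => (hc C hC).2.2.2 g x (hx C hC)⟩
  exact convex_image_val_iff.2 fun x hx y hy z a b ha hb hab hz => mem_sInter.2 fun C hC =>
    convex_image_val_iff.1 (hc C hC).2.2.1 x (hx C hC) y (hy C hC) z a b ha hb hab hz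

theorem isAffineGMap_incl (K : AffineFlow G) (C : Set K) (hC : K.IsAffineSubflow C) :
    IsAffineGMap (K.incl C hC) :=
  ⟨Continuous.subtype_mk continuous_subtype_val _, fun _ _ => rfl,
    fun _ _ _ _ _ _ _ _ h => h⟩

theorem range_incl (K : AffineFlow G) (C : Set K) (hC : K.IsAffineSubflow C) :
    range (K.incl C hC) = C :=
  subset_antisymm (range_subset_iff.2 fun x => K.ofImage_mem C x)
    fun x hx => ⟨⟨(x : K.E), mem_image_of_mem _ hx⟩, rfl⟩

theorem incl_injective (K : AffineFlow G) (C : Set K) (hC : K.IsAffineSubflow C) :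
    Function.Injective (K.incl C hC) :=
  fun _ _ h => Subtype.ext (congrArg (fun z : K => (z : K.E)) h)

/-- An affine extension is irreducible on a minimal affine subflow mapped onto the codomain. -/
theorem IsAffineExtension.isAffineGIrreducible_incl {K L : AffineFlow G} {φ : K → L}
    (hφ : IsAffineExtension φ) {C : Set K} (hC : K.IsAffineSubflow C)
    (hmin : Minimal (fun C : Set K => K.IsAffineSubflow C ∧ φ '' C = univ) C) :
    IsAffineGIrreducible (φ ∘ K.incl C hC) := by
  refine ⟨⟨hφ.1.comp (K.isAffineGMap_incl C hC), ?_⟩, fun D hD hDne h => hDne ?_⟩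
  · rw [← range_eq_univ, range_comp, range_incl, hmin.prop.2]
  · rw [image_comp] at h
    have hsub : K.incl C hC '' D ⊆ C :=
      (image_subset_range _ _).trans (K.range_incl C hC).le
    have hle := hmin.le_of_le ⟨hD.image (K.isAffineGMap_incl C hC), h⟩ hsub
    refine eq_univ_of_forall fun x => ?_
    obtain ⟨y, hy, hyx⟩ := hle ((K.range_incl C hC).le (mem_range_self x))
    rwa [← K.incl_injective C hC hyx]

/-- Affine projective covers are unique up to isomorphism over the base. -/
theorem IsAffineGProjectiveCover.exists_bijective {K L M : AffineFlow G} {φ : L → K} {ψ : M → K}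
    (hφ : IsAffineGProjectiveCover φ) (hψ : IsAffineGProjectiveCover ψ) :
    ∃ e : L → M, IsAffineGMap e ∧ Function.Bijective e ∧ ψ ∘ e = φ := by
  obtain ⟨e, he, heφ⟩ := hφ.1 _ _ φ ψ hφ.2.1.1 hψ.2.1
  obtain ⟨d, hd, hdψ⟩ := hψ.1 _ _ ψ φ hψ.2.1.1 hφ.2.1
  have h1 : d ∘ e = id := hφ.2.eq_of_comp_eq hφ.2 (hd.comp he) (isAffineGMap_id L)
    (by rw [← Function.comp_assoc, hdψ, heφ]) rfl
  have h2 : e ∘ d = id := hψ.2.eq_of_comp_eq hψ.2 (he.comp hd) (isAffineGMap_id M)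
    (by rw [← Function.comp_assoc, heφ, hdψ]) rfl
  exact ⟨e, he, Function.bijective_iff_has_inverse.2 ⟨d, congrFun h1, congrFun h2⟩, heφ⟩

end AffineFlow

/-! ### Dirac masses and barycenters -/

namespace GFlow

variable {G : Type u} [Group G] [TopologicalSpace G]

/-- A point of `P(X)`, as a functional on `C(X)`. -/
noncomputable def functional (X : GFlow G) (Λ : X.prob) : WeakDual ℝ C(X, ℝ) :=
  Subtype.val (p := fun Λ => Λ ∈ probMeasures X) Λ

theorem smul_dirac (X : GFlow G) (g : G) (x : X) : g • X.dirac x = X.dirac (g • x) :=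
  Subtype.ext (DFunLike.ext (F := WeakDual ℝ C(X, ℝ)) _ _ fun _ => rfl)

/-- Continuous functionals on the weak-* dual are evaluations. -/
theorem exists_eq_eval (X : GFlow G) (ℓ : StrongDual ℝ X.prob.E) :
    ∃ f : C(X, ℝ), ∀ Λ : X.prob, ℓ Λ = X.functional Λ f := by
  obtain ⟨f, hf⟩ := LinearMap.dualEmbedding_surjective (topDualPairing ℝ C(X, ℝ)) ℓ
  exact ⟨f, fun Λ => (DFunLike.congr_fun hf (X.functional Λ)).symm⟩

/-- `P(X)` is the closed convex hull of the Dirac masses. -/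
theorem eq_univ_of_dirac_mem {X : GFlow G} {C : Set X.prob} (hcl : IsClosed C)
    (hconv : Convex ℝ (Subtype.val '' C : Set X.prob.E)) (hdirac : ∀ x, X.dirac x ∈ C) :
    C = univ := by
  by_contra hne
  obtain ⟨Λ, hΛ⟩ := (ne_univ_iff_exists_notMem C).1 hne
  have hΛ' : (Λ : X.prob.E) ∉ (Subtype.val '' C : Set X.prob.E) := fun ⟨y, hy, hyΛ⟩ =>
    hΛ (Subtype.ext hyΛ ▸ hy)
  obtain ⟨ℓ, u, h1, h2⟩ := geometric_hahn_banach_closed_point hconv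
    (hcl.isCompact.image continuous_subtype_val).isClosed hΛ'
  obtain ⟨f, hf⟩ := X.exists_eq_eval ℓ
  have hpos := (mem_probMeasures_iff (X.functional Λ)).1 Λ.2
  -- Evaluating `ℓ` at Dirac masses gives `f ≤ u` pointwise; positivity and total mass one then give
  -- `ℓ Λ ≤ u`, against the separation.
  have h3 := hpos.1 (u • 1 - f) fun x => by
    have h := h1 _ ⟨_, hdirac x, rfl⟩
    rw [hf] at h
    simpa using! h.le
  rw [map_sub, map_smul, hpos.2, smul_eq_mul, mul_one, ← hf] at h3
  exact absurd h2 (not_lt.2 (sub_nonneg.1 h3))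

/-- Continuous affine maps on `P(X)` are determined by their values at the Dirac masses. -/
theorem eq_of_forall_dirac {X : GFlow G} {K : AffineFlow G} {φ ψ : X.prob → K}
    (hφ : Continuous φ) (hφ' : AffineFlow.PreservesCombos φ) (hψ : Continuous ψ)
    (hψ' : AffineFlow.PreservesCombos ψ) (h : ∀ x, φ (X.dirac x) = ψ (X.dirac x)) : φ = ψ :=
  funext fun Λ => (eq_univ_of_dirac_mem (isClosed_eq hφ hψ) (hφ'.convex_eqLocus hψ') h).ge
    (mem_univ Λ)

/-- The composition of a continuous functional with a continuous map to an affine flow. -/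
def evalComp {X : GFlow G} {K : AffineFlow G} {α : X → K} (hα : Continuous α)
    (ℓ : StrongDual ℝ K.E) : C(X, ℝ) :=
  ⟨fun x => ℓ (α x), ℓ.continuous.comp (continuous_subtype_val.comp hα)⟩

/-- The point `k` is the barycenter of the image of `Λ` under `α`. -/
def IsBarycenter {X : GFlow G} {K : AffineFlow G} {α : X → K} (hα : Continuous α)
    (Λ : X.prob) (k : K) : Prop :=
  ∀ ℓ : StrongDual ℝ K.E, ℓ k = X.functional Λ (evalComp hα ℓ)

section Barycenter

variable {X : GFlow G} {K : AffineFlow G} {α : X → K} (hα : Continuous α)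

theorem isBarycenter_dirac (x : X) : IsBarycenter hα (X.dirac x) (α x) := fun _ => rfl

/-- Continuous functionals separate the points of a Hausdorff locally convex space. -/
theorem IsBarycenter.eq {hα : Continuous α} {Λ : X.prob} {k k' : K} (h : IsBarycenter hα Λ k)
    (h' : IsBarycenter hα Λ k') : k = k' := by
  by_contra hne
  obtain ⟨ℓ, hℓ⟩ := geometric_hahn_banach_point_point (fun h => hne (Subtype.ext h))
  exact hℓ.ne ((h ℓ).trans (h' ℓ).symm)

theorem IsBarycenter.combo {hα : Continuous α} {Λ Λ' Λ'' : X.prob} {k k' k'' : K} {a b : ℝ}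
    (h : IsBarycenter hα Λ k) (h' : IsBarycenter hα Λ' k')
    (hΛ : (Λ'' : X.prob.E) = a • (Λ : X.prob.E) + b • (Λ' : X.prob.E))
    (hk : (k'' : K.E) = a • (k : K.E) + b • (k' : K.E)) : IsBarycenter hα Λ'' k'' := by
  intro ℓ
  rw [hk, map_add, map_smul, map_smul, h ℓ, h' ℓ]
  exact (DFunLike.congr_fun (F := WeakDual ℝ C(X, ℝ)) hΛ (evalComp hα ℓ)).symm

/-- Closedness of this graph in a compact space yields both the existence of barycenters and their
continuous dependence on the measure. -/
theorem isClosed_setOf_isBarycenter :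
    IsClosed {q : X.prob × K | IsBarycenter hα q.1 q.2} := by
  simp only [IsBarycenter, ofPred_forall]
  refine isClosed_iInter fun ℓ => isClosed_eq
    (ℓ.continuous.comp (continuous_subtype_val.comp continuous_snd)) ?_
  exact (WeakDual.eval_continuous (evalComp hα ℓ)).comp
    (continuous_subtype_val.comp continuous_fst)

/-- The measures with a barycenter form a closed convex set, the projection of a compact graph, and
it contains the Dirac masses. No vector-valued integral is needed. -/
theorem exists_isBarycenter (Λ : X.prob) : ∃ k, IsBarycenter hα Λ k := by
  have himg : Prod.fst '' {q : X.prob × K | IsBarycenter hα q.1 q.2} = univ := by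
    refine eq_univ_of_dirac_mem
      ((isClosed_setOf_isBarycenter hα).isCompact.image continuous_fst).isClosed ?_
      fun x => ⟨(X.dirac x, α x), isBarycenter_dirac hα x, rfl⟩
    rw [AffineFlow.convex_image_val_iff]
    rintro _ ⟨⟨Λ, k⟩, h, rfl⟩ _ ⟨⟨Λ', k'⟩, h', rfl⟩ Λ'' a b ha hb hab hΛ
    exact ⟨(Λ'', K.combo k k' ha hb hab), IsBarycenter.combo (hα := hα) h h' hΛ rfl, rfl⟩
  obtain ⟨⟨_, k⟩, hk, rfl⟩ := himg.ge (mem_univ Λ)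
  exact ⟨k, hk⟩

/-- The graph is compact and projects bijectively onto the Hausdorff space `P(X)`, so this
projection is a homeomorphism. -/
theorem continuous_of_isBarycenter {β : X.prob → K} (hβ : ∀ Λ, IsBarycenter hα Λ (β Λ)) :
    Continuous β := by
  let S : Set (X.prob × K) := {q | IsBarycenter hα q.1 q.2}
  have : CompactSpace S := isCompact_iff_compactSpace.1 (isClosed_setOf_isBarycenter hα).isCompact
  let e : S ≃ X.prob :=
    { toFun := fun q => q.1.1
      invFun := fun Λ => ⟨(Λ, β Λ), hβ Λ⟩
      left_inv := fun q => Subtype.ext (Prod.ext rfl (IsBarycenter.eq (hβ _) q.2))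
      right_inv := fun _ => rfl }
  have he : Continuous e := continuous_fst.comp continuous_subtype_val
  exact (continuous_snd.comp continuous_subtype_val).comp he.continuous_symm_of_equiv_compact_to_t2

/-- Every `G`-map from `X` to an affine flow extends to an affine `G`-map on `P(X)`. -/
theorem IsGMap.exists_extend_prob {α : X → K.toGFlow} (hα : IsGMap α) :
    ∃ β : X.prob → K, AffineFlow.IsAffineGMap β ∧ ∀ x, β (X.dirac x) = α x := by
  choose β hβ using exists_isBarycenter (K := K) hα.1
  have hcont : Continuous β := continuous_of_isBarycenter (K := K) hα.1 hβ
  have hcombo : AffineFlow.PreservesCombos β := fun x y z a b ha hb hab hz =>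
    congrArg Subtype.val <| IsBarycenter.eq (hβ z)
      (IsBarycenter.combo (k'' := K.combo (β x) (β y) ha hb hab) (hβ x) (hβ y) hz rfl)
  have hdirac : ∀ x, β (X.dirac x) = α x := fun x =>
    IsBarycenter.eq (hβ _) (isBarycenter_dirac (K := K) hα.1 x)
  refine ⟨β, ⟨hcont, fun g Λ => ?_, hcombo⟩, hdirac⟩
  -- Equivariance compares two continuous affine maps, so Dirac masses suffice.
  refine congrFun (eq_of_forall_dirac (φ := fun Λ => β (g • Λ)) (ψ := fun Λ => g • β Λ)
    (hcont.comp (continuous_const_smul (T := X.prob.toGFlow) g))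
    (hcombo.comp (X.prob.preservesCombos_smul g))
    ((continuous_const_smul (T := K.toGFlow) g).comp hcont)
    ((K.preservesCombos_smul g).comp hcombo) fun x => ?_) Λ
  rw [smul_dirac, hdirac, hdirac]
  exact hα.2 g x

end Barycenter

end GFlow

/-! ### Projectivity of minimal subflows and the main theorem -/

namespace AffineFlow

variable {G : Type u} [Group G] [TopologicalSpace G]

/-- A minimal affine subflow of `P(X)` mapped onto `K`, where `X` is a projective cover of the
closure of the extreme points of `K`, is affine projective. -/
theorem isAffineGProjective_restrict {K : AffineFlow G} {X : GFlow G} {p : X → K.extClosure}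
    (hp : GFlow.IsGProjectiveCover p) {φ : X.prob → K} (hφ : IsAffineExtension φ)
    (hφp : ∀ x : X, φ (X.dirac x) = K.extIncl (p x)) {L : Set X.prob}
    (hL : X.prob.IsAffineSubflow L)
    (hmin : Minimal (fun C : Set X.prob => X.prob.IsAffineSubflow C ∧ φ '' C = univ) L) :
    (X.prob.restrict L hL).IsAffineGProjective := by
  intro Q P θ π hθ hπ
  have hirr := hφ.isAffineGIrreducible_incl hL hmin
  have hincl := X.prob.isAffineGMap_incl L hL
  generalize X.prob.incl L hL = ι at hirr hincl
  generalize X.prob.restrict L hL = N at *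
  let T : GFlow G := N.toGFlow.prod P.toGFlow
  let f1 : T → N := Prod.fst
  let f2 : T → P := Prod.snd
  have hf1 : Continuous f1 := continuous_fst
  have hf2 : Continuous f2 := continuous_snd
  have hlift : ∀ n : N, ∃ t : T, θ (f1 t) = π (f2 t) ∧ f1 t = n := fun n => by
    obtain ⟨q, hq⟩ := hπ.2 (θ n)
    exact ⟨(n, q), hq.symm, rfl⟩
  -- The fibre product of `N` and `P` over `Q`; only its structure of a `G`-flow is needed.
  have hS : T.IsSubflow {t | θ (f1 t) = π (f2 t)} := by
    refine ⟨?_, isClosed_eq (hθ.1.comp hf1) (hπ.1.1.comp hf2), fun g t ht => ?_⟩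
    · obtain ⟨t, ht, -⟩ := hlift (Classical.arbitrary N)
      exact ⟨t, ht⟩
    · change θ (g • f1 t) = π (g • f2 t)
      rw [hθ.2.1, hπ.1.2.1, show θ (f1 t) = π (f2 t) from ht]
  have hi := T.isGMap_restrictIncl _ hS
  have hτ : GFlow.IsGMap (X := T.restrict _ hS) (Y := K.toGFlow)
      fun t => φ (ι (f1 (T.restrictIncl _ hS t))) :=
    ⟨hirr.1.1.1.comp (hf1.comp hi.1), fun g t => hirr.1.1.2.1 g _⟩
  obtain ⟨ψ, hψ, hψp⟩ := exists_lift_extIncl hp hτ fun k _ => by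
    obtain ⟨n, hn⟩ := hirr.1.2 k
    obtain ⟨t, ht, rfl⟩ := hlift n
    exact ⟨⟨t, ht⟩, hn⟩
  obtain ⟨β₁, hβ₁, hβ₁d⟩ := GFlow.IsGMap.exists_extend_prob (K := N)
    (α := fun x => f1 (T.restrictIncl _ hS (ψ x)))
    ⟨hf1.comp (hi.1.comp hψ.1), fun g x => by
      change f1 (T.restrictIncl _ hS (ψ (g • x))) = g • f1 (T.restrictIncl _ hS (ψ x))
      rw [hψ.2, hi.2]
      rfl⟩
  obtain ⟨β₂, hβ₂, hβ₂d⟩ := GFlow.IsGMap.exists_extend_prob (K := P)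
    (α := fun x => f2 (T.restrictIncl _ hS (ψ x)))
    ⟨hf2.comp (hi.1.comp hψ.1), fun g x => by
      change f2 (T.restrictIncl _ hS (ψ (g • x))) = g • f2 (T.restrictIncl _ hS (ψ x))
      rw [hψ.2, hi.2]
      rfl⟩
  -- On Dirac masses this says that `ψ` lifts `p`.
  have h1 : (φ ∘ ι) ∘ β₁ = φ := by
    have h := hirr.1.1.comp hβ₁
    refine GFlow.eq_of_forall_dirac h.1 h.2.2 hφ.1.1 hφ.1.2.2 fun x => ?_
    rw [hφp, ← hψp, Function.comp_apply, hβ₁d]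
    rfl
  -- On Dirac masses this is the equation defining the fibre product.
  have h2 : π ∘ β₂ = θ ∘ β₁ := by
    have h := hπ.1.comp hβ₂
    have h' := hθ.comp hβ₁
    refine GFlow.eq_of_forall_dirac h.1 h.2.2 h'.1 h'.2.2 fun x => ?_
    rw [Function.comp_apply, Function.comp_apply, hβ₁d, hβ₂d]
    exact (Subtype.prop (p := fun t : T => θ (f1 t) = π (f2 t)) (ψ x)).symm
  -- Rigidity: `β₁ ∘ ι` and the identity are both endomorphisms of `N` over `K`.
  have h3 : β₁ ∘ ι = id := hirr.eq_of_comp_eq hirr (hβ₁.comp hincl) (isAffineGMap_id N)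
    (by rw [← Function.comp_assoc, h1]) rfl
  refine ⟨β₂ ∘ ι, hβ₂.comp hincl, ?_⟩
  rw [← Function.comp_assoc, h2, Function.comp_assoc, h3, Function.comp_id]

end AffineFlow

theorem mainTheorem12 {G : Type u} [Group G] [TopologicalSpace G] [IsTopologicalGroup G]
    (K : AffineFlow G) (X : GFlow G) (p : X → K.extClosure) (hp : GFlow.IsGProjectiveCover p) :
    ∃ φ : X.prob → K, AffineFlow.IsAffineExtension φ ∧
      (∀ x : X, φ (X.dirac x) = K.extIncl (p x)) ∧
      (∃ L : Set X.prob,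
        Minimal (fun C : Set X.prob => X.prob.IsAffineSubflow C ∧ φ '' C = Set.univ) L) ∧
      ∀ (L : Set X.prob) (hL : X.prob.IsAffineSubflow L),
        Minimal (fun C : Set X.prob => X.prob.IsAffineSubflow C ∧ φ '' C = Set.univ) L →
        AffineFlow.IsAffineGProjectiveCover (φ ∘ X.prob.incl L hL) ∧
        ∀ (M : AffineFlow G) (ψ : M → K), AffineFlow.IsAffineGProjectiveCover ψ →
          ∃ e : X.prob.restrict L hL → M, AffineFlow.IsAffineGMap e ∧ Function.Bijective e ∧
            ψ ∘ e = φ ∘ X.prob.incl L hL := by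
  obtain ⟨φ, hφ, hφd⟩ := GFlow.IsGMap.exists_extend_prob (K := K)
    (K.isGMap_extIncl.comp hp.1.1.1)
  have hsurj : Function.Surjective φ := by
    rw [← range_eq_univ]
    -- Each extreme point is `p x` for some `x`, hence the image of a Dirac mass.
    refine AffineFlow.eq_univ_of_extPts_subset (isCompact_range hφ.1).isClosed ?_ fun e he => ?_
    · rw [← image_univ]
      exact AffineFlow.PreservesCombos.convex_image hφ.2.2 X.prob.convex_image_val_univ
    · obtain ⟨x, hx⟩ := hp.1.1.2 ⟨e, subset_closure he⟩
      exact ⟨X.dirac x, (hφd x).trans (congrArg K.extIncl hx)⟩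
  have hext : AffineFlow.IsAffineExtension φ := ⟨hφ, hsurj⟩
  refine ⟨φ, hext, hφd, hext.exists_minimal, fun L hL hmin => ?_⟩
  have hcover : AffineFlow.IsAffineGProjectiveCover (φ ∘ X.prob.incl L hL) :=
    ⟨AffineFlow.isAffineGProjective_restrict hp hext hφd hL hmin,
      hext.isAffineGIrreducible_incl hL hmin⟩
  exact ⟨hcover, fun M ψ hψ => hcover.exists_bijective hψ⟩
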